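/- Let $G$ be a nontrivial finite group, and let $F(G)$ be its Fitting subgroup, the subgroup generated by all nilpotent normal subgroups of $G$. Suppose that $G$ is $\mathcal N$-constrained, that is, $C_G(F(G))\le F(G)$. Let $I$ be a nilpotent injector of $G$, that is, a subgroup $I\le G$ such that for every subnormal subgroup $S$ of $G$ the intersection $S\cap I$ is a maximal nilpotent subgroup of $S$ (maximal among the nilpotent subgroups of $S$). Let $\mathcal X$ be the set of all subgroups of $G$ that are contained in at least one conjugate of $I$, ordered by inclusion, and let $\mu_{\mathcal X}$ be the Möbius function of this finite poset: for $x,y\in\mathcal X$, $\mu_{\mathcal X}(x,y)=0$ if $x\not\le y$, $\mu_{\mathcal X}(x,x)=1$, and $\mu_{\mathcal X}(x,y)=-\sum_{x\le z<y}\mu_{\mathcal X}(x,z)$ if $x<y$, where $z$ ranges over $\mathcal X$. Then $F(G)\le I$, so that $F(G)\in\mathcal X$, and the integer $$\theta_{\mathcal X}(F(G))=\sum_{K\in\mathcal X}\mu_{\mathcal X}(F(G),K)$$ is divisible by the index $(I:F(G))$. -/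

import Mathlib

open scoped Pointwise

/-- The Fitting subgroup: the subgroup generated by all nilpotent normal subgroups. -/
def fittingSubgroup (G : Type*) [Group G] : Subgroup G :=
  sSup {N : Subgroup G | N.Normal ∧ Group.IsNilpotent N}

/-- `G` is `𝒩`-constrained if the Fitting subgroup contains its own centralizer. -/
def IsNConstrained (G : Type*) [Group G] : Prop :=
  Subgroup.centralizer (fittingSubgroup G : Set G) ≤ fittingSubgroup G

/-- `I` is a nilpotent injector of `G` if, for each subnormal subgroup `S` of `G`, the intersection
`S ⊓ I` is a maximal nilpotent subgroup of `S`, that is, maximal among the nilpotent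
subgroups of `S`. -/
def IsNilpotentInjector {G : Type*} [Group G] (I : Subgroup G) : Prop :=
  ∀ S : Subgroup G, S.IsSubnormal →
    Maximal (fun N : Subgroup G => N ≤ S ∧ Group.IsNilpotent N) (S ⊓ I)

/-- The subgroups of `G` that are contained in at least one conjugate of `I`; as a set of
subgroups it is ordered by inclusion. -/
def subgroupsOfConjugates {G : Type*} [Group G] (I : Subgroup G) : Set (Subgroup G) :=
  {K | ∃ g : G, K ≤ MulAut.conj g • I}

theorem mem_subgroupsOfConjugates_of_le {G : Type*} [Group G] {I K : Subgroup G} (h : K ≤ I) :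
    K ∈ subgroupsOfConjugates I :=
  ⟨1, by simpa using h⟩

open Classical in
/-- The Möbius function of a finite poset, with integer values: Mathlib's Möbius function, with
the (unique) interval structure of a finite poset. -/
noncomputable def moebius {P : Type*} [PartialOrder P] [Finite P] (x y : P) : ℤ :=
  letI : Fintype P := Fintype.ofFinite P
  letI : LocallyFiniteOrder P := Fintype.toLocallyFiniteOrder
  IncidenceAlgebra.mu ℤ x y

/-- `θ_𝒳(H) = ∑_{K ∈ 𝒳} μ_𝒳(H, K)`, for a set `𝒳` of subgroups of a finite group, ordered by
inclusion, and a member `H` of `𝒳`. -/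
noncomputable def moebiusSum {G : Type*} [Group G] [Finite G] (X : Set (Subgroup G)) (H : X) : ℤ :=
  letI : Fintype X := Fintype.ofFinite X
  ∑ K : X, moebius H K

/-! Write F for the Fitting subgroup. By Philip Hall's theorem, θ(F) is the signed count `chainSum`
of chains of members of 𝒳 strictly above F. `I` permutes these chains by conjugation and F fixes
them all. If F < B ≤ I, the chains fixed by B are those of the members K > F normalized by B, and K
↦ KB contracts that poset onto B, so their signed count is 0. Hence only chains with stabilizer
exactly F contribute, in orbits of length |I : F| (`index_dvd_chainSum`). The contraction needs KB
to be in 𝒳. Let C_p be the centralizer in G of the p'-elements of F (`primeComplCentralizer`). As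
C_p ∩ C_q ≤ C_G(F) ≤ F for p ≠ q, a subgroup K ≥ F is nilpotent exactly when its p-elements lie in
C_p for every p. This is an index condition that passes to KB (`isNilpotent_sup_of_le_normalizer`),
and every nilpotent subgroup above F lies in a conjugate of `I` (`exists_le_conj_of_isNilpotent`).
-/

/-! ### Signed chain counts and the Möbius function. -/

section ChainSum

variable {P : Type*} [PartialOrder P]

open Classical in
/-- The sum of `(-1) ^ |σ|` over the chains `σ ⊆ L`, the empty chain included; up to sign, the
reduced Euler characteristic of the order complex of `L`. -/
noncomputable def chainSum (L : Finset P) : ℤ :=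
  ∑ σ ∈ L.powerset, if IsChain (· ≤ ·) (σ : Set P) then (-1) ^ σ.card else 0

-- Deleting x from a chain through x leaves a chain of elements comparable to x and flips the sign.
open Classical in
theorem chainSum_eq_erase_sub {L : Finset P} {x : P} (hx : x ∈ L) :
    chainSum L = chainSum (L.erase x)
      - chainSum ((L.erase x).filter fun y => y ≤ x ∨ x ≤ y) := by
  have hL : chainSum L = chainSum (insert x (L.erase x)) := by rw [Finset.insert_erase hx]
  rw [hL]
  unfold chainSum
  rw [Finset.sum_powerset_insert (Finset.notMem_erase x L), sub_eq_add_neg, add_right_inj,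
    ← Finset.sum_neg_distrib]
  symm
  refine Finset.sum_subset_zero_on_sdiff
    (Finset.powerset_mono.2 (Finset.filter_subset _ _)) ?_ ?_
  · intro σ hσ
    simp only [Finset.mem_sdiff, Finset.mem_powerset] at hσ
    rw [if_neg]
    intro hc
    refine hσ.2 fun y hy => Finset.mem_filter.2 ⟨hσ.1 hy, ?_⟩
    exact hc.total (by simp [hy]) (by simp)
  · intro σ hσ
    simp only [Finset.mem_powerset] at hσ
    have hxσ : x ∉ σ := fun h => by simpa using hσ h
    have : IsChain (· ≤ ·) ((insert x σ : Finset P) : Set P) ↔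
        IsChain (· ≤ ·) (σ : Set P) := by
      rw [Finset.coe_insert]
      refine ⟨fun h => h.mono (Set.subset_insert _ _), fun h => h.insert fun b hb _ => ?_⟩
      exact (Finset.mem_filter.1 (hσ hb)).2.symm
    simp only [this, Finset.card_insert_of_notMem hxσ]
    split_ifs <;> ring

theorem chainSum_eq_zero_of_forall_comparable {L : Finset P} {b : P} (hb : b ∈ L)
    (h : ∀ x ∈ L, x ≤ b ∨ b ≤ x) : chainSum L = 0 := by
  classical
  rw [chainSum_eq_erase_sub hb, Finset.filter_true_of_mem, sub_self]
  exact fun y hy => h y (Finset.mem_of_mem_erase hy)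

/-- A finite poset in which every element has a join with a fixed element `b` is contractible. -/
theorem chainSum_eq_zero_of_exists_isLUB {b : P} (L : Finset P) (hb : b ∈ L)
    (h : ∀ x ∈ L, ∃ j ∈ L, IsLUB {x, b} j) : chainSum L = 0 := by
  classical
  induction L using Finset.strongInduction with
  | H L ih =>
  by_cases hall : ∀ x ∈ L, b ≤ x
  · exact chainSum_eq_zero_of_forall_comparable hb fun x hx => Or.inr (hall x hx)
  push Not at hall
  obtain ⟨x₀, hx₀, hbx₀⟩ := hall
  -- By maximality everything above x in L is above b, hence above the join j of x and b. So the
  -- elements comparable to x form a cone with apex j, and x can be removed; joins with b survive,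
  -- since they lie above b and x does not.
  obtain ⟨x, hx⟩ := (L.filter fun x => ¬ b ≤ x).exists_maximal ⟨x₀, by simp [hx₀, hbx₀]⟩
  obtain ⟨hxL, hbx⟩ := Finset.mem_filter.1 hx.prop
  have hge : ∀ y ∈ L, x < y → b ≤ y := fun y hy hxy => by
    by_contra hby
    exact hx.not_prop_of_gt hxy (Finset.mem_filter.2 ⟨hy, hby⟩)
  obtain ⟨j, hjL, hj⟩ := h x hxL
  have hxj : x ≤ j := hj.1 (by simp)
  have hbj : b ≤ j := hj.1 (by simp)
  have hne : j ≠ x := fun e => hbx (e ▸ hbj)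
  rw [chainSum_eq_erase_sub hxL, ih _ (Finset.erase_ssubset hxL), zero_sub, neg_eq_zero]
  · refine chainSum_eq_zero_of_forall_comparable (b := j) (by simp [hne, hjL, hxj]) ?_
    intro y hy
    simp only [Finset.mem_filter, Finset.mem_erase] at hy
    obtain ⟨⟨hyx, hyL⟩, hy | hy⟩ := hy
    · exact Or.inl (hy.trans hxj)
    · refine Or.inr (hj.2 ?_)
      rintro z (rfl | rfl)
      · exact hy
      · exact hge y hyL (lt_of_le_of_ne hy hyx.symm)
  · exact Finset.mem_erase.2 ⟨fun e => hbx (e ▸ le_rfl), hb⟩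
  · intro y hy
    obtain ⟨k, hkL, hk⟩ := h y (Finset.mem_of_mem_erase hy)
    refine ⟨k, Finset.mem_erase.2 ⟨?_, hkL⟩, hk⟩
    rintro rfl
    exact hbx (hk.1 (by simp))

-- Nonempty chains are sorted by their largest element x; the 1 is the empty chain.
open Classical in
theorem chainSum_eq_one_sub_sum (L : Finset P) :
    chainSum L = 1 - ∑ x ∈ L, chainSum (L.filter (· < x)) := by
  induction L using Finset.strongInduction with
  | H L ih =>
  rcases L.eq_empty_or_nonempty with rfl | hne
  · simp [chainSum]
  obtain ⟨x, hx⟩ := L.exists_maximal hne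
  have hlt : ∀ y ∈ L, ¬ x < y := fun y hy h => hx.not_prop_of_gt h hy
  rw [chainSum_eq_erase_sub hx.prop, ih _ (Finset.erase_ssubset hx.prop),
    ← Finset.add_sum_erase L _ hx.prop]
  have h1 : (L.erase x).filter (fun y => y ≤ x ∨ x ≤ y) = L.filter (· < x) := by
    ext y
    simp only [Finset.mem_filter, Finset.mem_erase]
    constructor
    · rintro ⟨⟨hyx, hy⟩, h | h⟩
      · exact ⟨hy, lt_of_le_of_ne h hyx⟩
      · exact absurd (lt_of_le_of_ne h hyx.symm) (hlt y hy)
    · rintro ⟨hy, h⟩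
      exact ⟨⟨h.ne, hy⟩, Or.inl h.le⟩
  have h2 : ∀ y ∈ L.erase x, (L.erase x).filter (· < y) = L.filter (· < y) := by
    intro y hy
    rw [Finset.filter_erase, Finset.erase_eq_of_notMem]
    simp [hlt y (Finset.mem_of_mem_erase hy)]
  rw [h1, Finset.sum_congr rfl fun y hy => by rw [h2 y hy]]
  ring

open Classical in
/-- Philip Hall's theorem. -/
theorem moebius_eq_neg_chainSum [Fintype P] {x y : P} (h : x < y) :
    moebius x y = - chainSum (Finset.univ.filter fun z => x < z ∧ z < y) := by
  induction y using WellFoundedLT.induction with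
  | ind y ih =>
  unfold moebius at ih ⊢
  rw [Subsingleton.elim (Fintype.ofFinite P) ‹Fintype P›] at ih ⊢
  let : LocallyFiniteOrder P := Fintype.toLocallyFiniteOrder
  rw [IncidenceAlgebra.mu_eq_neg_sum_Ico_of_ne h.ne, neg_inj, ← Finset.Ioo_insert_left h,
    Finset.sum_insert Finset.left_notMem_Ioo, IncidenceAlgebra.mu_self, chainSum_eq_one_sub_sum,
    sub_eq_add_neg, add_right_inj, ← Finset.sum_neg_distrib]
  refine Finset.sum_congr (by ext; simp) fun z hz => ?_
  simp only [Finset.mem_filter, Finset.mem_univ, true_and] at hz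
  rw [ih z hz.2 hz.1, neg_inj]
  congr 1
  ext w
  simp only [Finset.mem_filter, Finset.mem_univ, true_and]
  exact ⟨fun hw => ⟨⟨hw.1, hw.2.trans hz.2⟩, hw.2⟩, fun hw => ⟨hw.1.1, hw.2⟩⟩

open Classical in
theorem sum_moebius_eq_chainSum [Fintype P] (x : P) :
    ∑ y, moebius x y = chainSum (Finset.univ.filter fun z => x < z) := by
  have hself : moebius x x = 1 := by
    unfold moebius
    let : Fintype P := Fintype.ofFinite P
    let : LocallyFiniteOrder P := Fintype.toLocallyFiniteOrder
    exact IncidenceAlgebra.mu_self _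
  have hnle : ∀ y, ¬ x ≤ y → moebius x y = 0 := fun y hy => by
    unfold moebius
    let : Fintype P := Fintype.ofFinite P
    let : LocallyFiniteOrder P := Fintype.toLocallyFiniteOrder
    exact IncidenceAlgebra.apply_eq_zero_of_not_le hy _
  rw [chainSum_eq_one_sub_sum, ← Finset.add_sum_erase _ _ (Finset.mem_univ x), hself,
    sub_eq_add_neg, add_right_inj, ← Finset.sum_neg_distrib]
  symm
  refine Finset.sum_subset_zero_on_sdiff ?_ ?_ ?_
  · intro y hy
    simp only [Finset.mem_filter, Finset.mem_univ, true_and] at hy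
    simp [hy.ne']
  · intro y hy
    simp only [Finset.mem_sdiff, Finset.mem_erase, Finset.mem_filter, Finset.mem_univ,
      true_and, and_true] at hy
    exact hnle y fun h => hy.2 (lt_of_le_of_ne h (Ne.symm hy.1))
  · intro y hy
    simp only [Finset.mem_filter, Finset.mem_univ, true_and] at hy
    rw [moebius_eq_neg_chainSum hy, Finset.filter_filter]

end ChainSum

/-! ### Divisibility from group actions on chains. -/

section Action

variable {A : Type*} [Group A] [Finite A]

open Classical in
/-- If an invariant weight sums to zero over the fixed points of each subgroup properly containing
`N`, then its total sum is divisible by the index of `N`. -/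
theorem index_dvd_sum_of_forall_fixedPoints {Ω : Type*} [MulAction A Ω] (S : Finset Ω) (w : Ω → ℤ)
    (hS : ∀ (a : A), ∀ ω ∈ S, a • ω ∈ S) (hw : ∀ (a : A) (ω : Ω), w (a • ω) = w ω)
    (N : Subgroup A) (hN : ∀ ω ∈ S, N ≤ MulAction.stabilizer A ω)
    (hB : ∀ B : Subgroup A, N < B →
      ∑ ω ∈ S.filter (fun ω => B ≤ MulAction.stabilizer A ω), w ω = 0) :
    (N.index : ℤ) ∣ ∑ ω ∈ S, w ω := by
  -- Downward induction on B: the points fixed by B split by exact stabilizer C ≥ B, and the terms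
  -- with C > B already vanish.
  have hexact : ∀ B : Subgroup A, N < B →
      ∑ ω ∈ S.filter (fun ω => MulAction.stabilizer A ω = B), w ω = 0 := by
    intro B
    induction B using WellFoundedGT.induction with
    | ind B ih =>
    intro hNB
    have hsum := hB B hNB
    rw [← Finset.sum_fiberwise_of_maps_to
      (t := (Set.toFinite {C : Subgroup A | B ≤ C}).toFinset)
      (g := fun ω => MulAction.stabilizer A ω) (by simp)] at hsum
    rw [← hsum, Finset.sum_eq_single B, Finset.filter_filter]
    · congr 1
      ext ω
      simp only [Finset.mem_filter]
      exact ⟨fun h => ⟨h.1, h.2.ge, h.2⟩, fun h => ⟨h.1, h.2.2⟩⟩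
    · intro C hC hCB
      simp only [Set.Finite.mem_toFinset, Set.mem_ofPred_eq] at hC
      have hBC : B < C := lt_of_le_of_ne hC hCB.symm
      rw [← ih C hBC (hNB.trans hBC), Finset.filter_filter]
      congr 1
      ext ω
      simp only [Finset.mem_filter]
      exact ⟨fun h => ⟨h.1, h.2.2⟩, fun h => ⟨h.1, h.2 ▸ hC, h.2⟩⟩
    · simp
  rw [← Finset.sum_fiberwise_of_maps_to
      (t := (Set.toFinite {C : Subgroup A | N ≤ C}).toFinset)
      (g := fun ω => MulAction.stabilizer A ω) (by simpa using hN)]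
  refine Finset.dvd_sum fun C hC => ?_
  rcases eq_or_lt_of_le (show N ≤ C by simpa using hC) with rfl | hlt
  swap
  · rw [hexact C hlt]
    exact dvd_zero _
  rw [← Finset.sum_fiberwise_of_maps_to
    (t := (S.image fun ω => MulAction.orbit A ω))
    (g := fun ω => MulAction.orbit A ω)
    (fun ω hω => Finset.mem_image_of_mem _ (Finset.mem_filter.1 hω).1)]
  refine Finset.dvd_sum fun O hO => ?_
  rcases Finset.eq_empty_or_nonempty ({ω ∈ {ω ∈ S | MulAction.stabilizer A ω = N} |
    MulAction.orbit A ω = O}) with he | ⟨ω₀, hω₀⟩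
  · rw [he, Finset.sum_empty]
    exact dvd_zero _
  simp only [Finset.mem_filter] at hω₀
  obtain ⟨⟨hS₀, hst⟩, rfl⟩ := hω₀
  rw [Finset.sum_congr rfl (g := fun _ => w ω₀)]
  · rw [Finset.sum_const, nsmul_eq_mul]
    refine Dvd.dvd.mul_right ?_ _
    rw [← hst, MulAction.index_stabilizer, ← Set.ncard_coe_finset]
    refine dvd_of_eq ?_
    congr 2
    ext ω
    simp only [Finset.coe_filter, Finset.mem_filter, Set.mem_ofPred_eq]
    constructor
    · rintro ⟨a, rfl⟩
      refine ⟨⟨hS a _ hS₀, ?_⟩, MulAction.orbit_smul a ω₀⟩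
      -- The stabilizer of a translate is a conjugate of N that contains N, so it equals N by order.
      refine (Subgroup.eq_of_le_of_card_ge (hst.le.trans (hN _ (hS a _ hS₀))) ?_).symm
      rw [MulAction.stabilizer_smul_eq_stabilizer_map_conj]
      exact (Subgroup.card_map_of_injective (MulEquiv.injective _)).le
    · exact fun h => MulAction.orbit_eq_iff.1 h.2
  · intro ω hω
    obtain ⟨a, ha⟩ := MulAction.orbit_eq_iff.1 (Finset.mem_filter.1 hω).2
    rw [← ha]
    exact hw a ω₀

open Classical in
theorem index_dvd_chainSum {P : Type*} [PartialOrder P] [MulAction A P]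
    (hmono : ∀ (a : A) (x y : P), x ≤ y → a • x ≤ a • y) (N : Subgroup A) (L : Finset P)
    (hL : ∀ (a : A), ∀ x ∈ L, a • x ∈ L) (hN : ∀ x ∈ L, N ≤ MulAction.stabilizer A x)
    (hB : ∀ B : Subgroup A, N < B →
      chainSum (L.filter fun x => B ≤ MulAction.stabilizer A x) = 0) :
    (N.index : ℤ) ∣ chainSum L := by
  have hsmul : ∀ (a : A) (x y : P), a • x ≤ a • y ↔ x ≤ y := fun a x y =>
    ⟨fun h => by simpa using hmono a⁻¹ _ _ h, hmono a x y⟩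
  -- x ≤ ax ≤ a²x ≤ ... returns to x because a has finite order. Hence stabilizing a chain means
  -- fixing each of its elements.
  have hfix : ∀ (a : A) (x : P), x ≤ a • x → a • x = x := by
    intro a x h
    have hpow : ∀ n : ℕ, a • x ≤ a ^ (n + 1) • x := by
      intro n
      induction n with
      | zero => simp
      | succ n ih =>
        refine ih.trans ?_
        rw [pow_succ a (n + 1), mul_smul, hsmul]
        exact h
    have := hpow (orderOf a - 1)
    rw [Nat.sub_add_cancel (orderOf_pos a), pow_orderOf_eq_one, one_smul] at this
    exact le_antisymm this h
  have hchain : ∀ (a : A) (σ : Finset P), IsChain (· ≤ ·) ((a • σ : Finset P) : Set P) ↔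
      IsChain (· ≤ ·) (σ : Set P) := by
    have : ∀ (a : A) (σ : Finset P), IsChain (· ≤ ·) (σ : Set P) →
        IsChain (· ≤ ·) ((a • σ : Finset P) : Set P) := by
      intro a σ h
      rw [Finset.coe_smul_finset]
      rintro _ ⟨x, hx, rfl⟩ _ ⟨y, hy, rfl⟩ -
      exact (h.total hx hy).imp (hmono a _ _) (hmono a _ _)
    exact fun a σ => ⟨fun h => by simpa using this a⁻¹ _ h, this a σ⟩
  have hstab : ∀ (B : Subgroup A) (σ : Finset P), IsChain (· ≤ ·) (σ : Set P) →
      (B ≤ MulAction.stabilizer A σ ↔ ∀ x ∈ σ, B ≤ MulAction.stabilizer A x) := by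
    intro B σ hσ
    constructor
    · intro h x hx a ha
      rw [MulAction.mem_stabilizer_iff]
      have hax : a • x ∈ σ := by
        rw [← MulAction.mem_stabilizer_iff.1 (h ha)]
        exact Finset.smul_mem_smul_finset hx
      rcases hσ.total hx hax with hle | hle
      · exact hfix a x hle
      · have := hfix a⁻¹ x (by simpa using hmono a⁻¹ _ _ hle)
        rw [← this, smul_inv_smul, this]
    · intro h a ha
      rw [MulAction.mem_stabilizer_iff]
      refine Finset.eq_of_subset_of_card_le ?_ (Finset.card_smul_finset _ _).ge
      intro y hy
      obtain ⟨x, hx, rfl⟩ := Finset.mem_smul_finset.1 hy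
      rw [MulAction.mem_stabilizer_iff.1 (h x hx ha)]
      exact hx
  have hsum : ∀ M : Finset P, chainSum M =
      ∑ σ ∈ M.powerset.filter (fun σ : Finset P => IsChain (· ≤ ·) (σ : Set P)),
        (-1) ^ σ.card := fun M => (Finset.sum_filter _ _).symm
  rw [hsum]
  refine index_dvd_sum_of_forall_fixedPoints _ (fun σ : Finset P => (-1 : ℤ) ^ σ.card)
    ?_ ?_ N ?_ ?_
  · intro a σ hσ
    simp only [Finset.mem_filter, Finset.mem_powerset, hchain] at hσ ⊢
    refine ⟨fun y hy => ?_, hσ.2⟩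
    obtain ⟨x, hx, rfl⟩ := Finset.mem_smul_finset.1 hy
    exact hL a x (hσ.1 hx)
  · intro a σ
    simp
  · intro σ hσ
    simp only [Finset.mem_filter, Finset.mem_powerset] at hσ
    exact (hstab N σ hσ.2).2 fun x hx => hN x (hσ.1 hx)
  · intro B hNB
    rw [← hB B hNB, hsum]
    congr 1
    ext σ
    simp only [Finset.mem_filter, Finset.mem_powerset, Finset.subset_iff]
    constructor
    · exact fun h => ⟨fun x hx => ⟨h.1.1 hx, (hstab B σ h.1.2).1 h.2 x hx⟩, h.1.2⟩
    · exact fun h => ⟨⟨fun x hx => (h.1 hx).1, h.2⟩, (hstab B σ h.2).2 fun x hx => (h.1 hx).2⟩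

end Action

/-! ### Nilpotency through elements of prime power order. -/

section PrimeElements

variable {G : Type*} [Group G] [Finite G]

/-- H contains a Sylow q-subgroup of K for each q, so no prime divides |K : H ∩ K|. -/
theorem Subgroup.le_of_forall_pow_prime_pow {H K : Subgroup G}
    (h : ∀ q : ℕ, q.Prime → ∀ y ∈ K, (∃ k : ℕ, y ^ q ^ k = 1) → y ∈ H) : K ≤ H := by
  rw [← Subgroup.relIndex_eq_one]
  by_contra hne
  obtain ⟨q, hq, hdvd⟩ := Nat.exists_prime_and_dvd hne
  have : Fact q.Prime := ⟨hq⟩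
  obtain ⟨S⟩ : Nonempty (Sylow q K) := inferInstance
  refine S.not_dvd_index (hdvd.trans (Subgroup.index_dvd_of_le ?_))
  intro y hy
  obtain ⟨k, hk⟩ := S.isPGroup' ⟨y, hy⟩
  exact h q hq y y.2 ⟨k, by simpa [Subtype.ext_iff] using hk⟩

/-- The elements of `p`-power order of a finite nilpotent group form a subgroup. -/
theorem Subgroup.exists_isPGroup_forall_mem_iff {K : Subgroup G} (hK : Group.IsNilpotent K)
    {p : ℕ} (hp : p.Prime) :
    ∃ S : Subgroup G, IsPGroup p S ∧ ∀ x, x ∈ S ↔ x ∈ K ∧ ∃ k : ℕ, x ^ p ^ k = 1 := by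
  have : Fact p.Prime := ⟨hp⟩
  obtain ⟨S⟩ : Nonempty (Sylow p K) := inferInstance
  refine ⟨(S : Subgroup K).map K.subtype, S.isPGroup'.map _, fun x => ⟨?_, ?_⟩⟩
  · rintro ⟨y, hy, rfl⟩
    obtain ⟨k, hk⟩ := S.isPGroup' ⟨y, hy⟩
    exact ⟨y.2, k, by simpa [Subtype.ext_iff] using hk⟩
  · rintro ⟨hx, k, hk⟩
    refine ⟨⟨x, hx⟩, ?_, rfl⟩
    have hz : IsPGroup p (Subgroup.zpowers (⟨x, hx⟩ : K)) := by
      rw [IsPGroup.iff_card, Nat.card_zpowers]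
      obtain ⟨m, -, hm⟩ := (Nat.dvd_prime_pow hp).1
        (orderOf_dvd_of_pow_eq_one (show (⟨x, hx⟩ : K) ^ p ^ k = 1 from Subtype.ext hk))
      exact ⟨m, hm⟩
    obtain ⟨T, hT⟩ := hz.exists_le_sylow
    have hle := T.isPGroup'.le_sylow_of_normal S
    exact hle (hT (Subgroup.mem_zpowers _))

omit [Finite G] in
theorem eq_one_of_pow_prime_pow_eq_one {p q : ℕ} (hp : p.Prime) (hq : q.Prime) (hpq : p ≠ q)
    {x : G} (hx : ∃ k : ℕ, x ^ p ^ k = 1) (hy : ∃ k : ℕ, x ^ q ^ k = 1) : x = 1 := by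
  obtain ⟨k, hk⟩ := hx
  obtain ⟨l, hl⟩ := hy
  rw [← orderOf_eq_one_iff]
  exact Nat.eq_one_of_dvd_coprimes (Nat.coprime_pow_primes k l hp hq hpq)
    (orderOf_dvd_of_pow_eq_one hk) (orderOf_dvd_of_pow_eq_one hl)

omit [Finite G] in
theorem conj_pow_eq_one {p : ℕ} {x : G} (g : G) (hx : ∃ k : ℕ, x ^ p ^ k = 1) :
    ∃ k : ℕ, (g * x * g⁻¹) ^ p ^ k = 1 := by
  obtain ⟨k, hk⟩ := hx
  exact ⟨k, by rw [conj_pow, hk]; simp⟩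

theorem Subgroup.commute_of_isNilpotent {K : Subgroup G} (hK : Group.IsNilpotent K) {p q : ℕ}
    (hp : p.Prime) (hq : q.Prime) (hpq : p ≠ q) {x y : G} (hxK : x ∈ K) (hyK : y ∈ K)
    (hx : ∃ k : ℕ, x ^ p ^ k = 1) (hy : ∃ k : ℕ, y ^ q ^ k = 1) : Commute x y := by
  obtain ⟨S, -, hS⟩ := Subgroup.exists_isPGroup_forall_mem_iff hK hp
  obtain ⟨T, -, hT⟩ := Subgroup.exists_isPGroup_forall_mem_iff hK hq
  -- The commutator, bracketed in two ways, is both a p-element and a q-element.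
  have h1 : x * (y * x⁻¹ * y⁻¹) ∈ S := by
    refine S.mul_mem ((hS x).2 ⟨hxK, hx⟩) ((hS _).2 ⟨?_, conj_pow_eq_one y ?_⟩)
    · exact K.mul_mem (K.mul_mem hyK (K.inv_mem hxK)) (K.inv_mem hyK)
    · obtain ⟨k, hk⟩ := hx
      exact ⟨k, by simp [hk]⟩
  have h2 : (x * y * x⁻¹) * y⁻¹ ∈ T := by
    refine T.mul_mem ((hT _).2 ⟨?_, conj_pow_eq_one x hy⟩) (T.inv_mem ((hT y).2 ⟨hyK, hy⟩))
    exact K.mul_mem (K.mul_mem hxK hyK) (K.inv_mem hxK)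
  have h3 := eq_one_of_pow_prime_pow_eq_one hp hq hpq ((hS _).1 h1).2
    (by simpa [mul_assoc] using ((hT _).1 h2).2)
  rw [← commutatorElement_eq_one_iff_commute, commutatorElement_def]
  simpa [mul_assoc] using h3

/-- The normalizer of a Sylow p-subgroup P contains P and, for q ≠ p, a Sylow q-subgroup, which
centralizes P; so its index is 1. -/
theorem Subgroup.isNilpotent_of_commute {K : Subgroup G}
    (h : ∀ p q : ℕ, p.Prime → q.Prime → p ≠ q → ∀ x ∈ K, ∀ y ∈ K, (∃ k : ℕ, x ^ p ^ k = 1) →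
      (∃ k : ℕ, y ^ q ^ k = 1) → Commute x y) : Group.IsNilpotent K := by
  refine (Group.isNilpotent_of_finite_tfae.out 0 3 rfl rfl).2 fun p hp P => ?_
  rw [← Subgroup.normalizer_eq_top_iff, ← Subgroup.index_eq_one]
  by_contra hne
  obtain ⟨q, hq, hdvd⟩ := Nat.exists_prime_and_dvd hne
  have : Fact q.Prime := ⟨hq⟩
  rcases eq_or_ne p q with rfl | hpq
  · exact P.not_dvd_index (hdvd.trans (Subgroup.index_dvd_of_le Subgroup.le_normalizer))
  obtain ⟨S⟩ : Nonempty (Sylow q K) := inferInstance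
  refine S.not_dvd_index (hdvd.trans (Subgroup.index_dvd_of_le ?_))
  refine le_trans ?_ (Subgroup.centralizer_le_normalizer _)
  intro y hy
  rw [Subgroup.mem_centralizer_iff]
  intro x hx
  obtain ⟨k, hk⟩ := S.isPGroup' ⟨y, hy⟩
  obtain ⟨l, hl⟩ := P.isPGroup' ⟨x, hx⟩
  refine Subtype.ext (h p q hp.out hq hpq x x.2 y y.2 ⟨l, ?_⟩ ⟨k, ?_⟩).eq
  · simpa [Subtype.ext_iff] using hl
  · simpa [Subtype.ext_iff] using hk

end PrimeElements

open scoped commutatorElement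

/-! ### Indices in products of subgroups. -/

section RelIndex

variable {G : Type*} [Group G]

theorem Subgroup.isNilpotent_of_le {H K : Subgroup G} (h : H ≤ K) (hK : Group.IsNilpotent K) :
    Group.IsNilpotent H :=
  have : Group.IsNilpotent (H.subgroupOf K) := Subgroup.isNilpotent _
  Group.nilpotent_of_mulEquiv (Subgroup.subgroupOfEquivOfLe h)

theorem Subgroup.relIndex_sup_of_le_normalizer {M Q : Subgroup G}
    (h : Q ≤ Subgroup.normalizer (M : Set G)) : M.relIndex (M ⊔ Q) = M.relIndex Q := by
  have hM : M ≤ Subgroup.normalizer (M : Set G) := Subgroup.le_normalizer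
  rw [← Subgroup.relIndex_subgroupOf (sup_le hM h), Subgroup.subgroupOf_sup hM h,
    Subgroup.relIndex_sup_left, Subgroup.relIndex_subgroupOf h]

/-- |CKQ : C| = |CK : C| |CKQ : CK|, and the last factor divides |Q : Q ∩ C|. -/
theorem Subgroup.relIndex_sup_dvd_mul {C K Q : Subgroup G} [C.Normal]
    (h : Q ≤ Subgroup.normalizer (K : Set G)) :
    C.relIndex (K ⊔ Q) ∣ C.relIndex K * C.relIndex Q := by
  have hQ : Q ≤ Subgroup.normalizer ((C ⊔ K : Subgroup G) : Set G) := by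
    intro q hq
    rw [Subgroup.mem_normalizer_iff_map_conj_eq, Subgroup.map_sup,
      Subgroup.mem_normalizer_iff_map_conj_eq.1 (h hq)]
    congr 1
    refine Subgroup.mem_normalizer_iff_map_conj_eq.1 ?_
    rw [Subgroup.normalizer_eq_top]
    trivial
  rw [← Subgroup.relIndex_sup_left (K ⊔ Q) C, ← sup_assoc,
    ← Subgroup.relIndex_mul_relIndex C (C ⊔ K) (C ⊔ K ⊔ Q) le_sup_left le_sup_left,
    Subgroup.relIndex_sup_left, Subgroup.relIndex_sup_of_le_normalizer hQ]
  exact mul_dvd_mul_left _ (Subgroup.relIndex_dvd_of_le_left Q le_sup_left)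

/-- Turns a condition on p-elements, not visibly stable under products, into one on indices. -/
theorem Subgroup.not_dvd_relIndex_iff [Finite G] {C K : Subgroup G} [C.Normal] {p : ℕ}
    (hp : p.Prime) :
    ¬ p ∣ C.relIndex K ↔ ∀ x ∈ K, (∃ k : ℕ, x ^ p ^ k = 1) → x ∈ C := by
  constructor
  · rintro h x hx ⟨k, hk⟩
    have h1 : orderOf (QuotientGroup.mk (s := C.subgroupOf K) ⟨x, hx⟩) ∣ p ^ k := by
      refine orderOf_dvd_of_pow_eq_one ?_
      rw [← QuotientGroup.mk_pow, QuotientGroup.eq_one_iff, Subgroup.mem_subgroupOf]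
      simp [hk]
    have h2 : orderOf (QuotientGroup.mk (s := C.subgroupOf K) ⟨x, hx⟩) ∣ C.relIndex K :=
      _root_.orderOf_dvd_natCard _
    have h3 := Nat.eq_one_of_dvd_coprimes
      (Nat.Coprime.pow_left k ((Nat.Prime.coprime_iff_not_dvd hp).2 h)) h1 h2
    rw [orderOf_eq_one_iff, QuotientGroup.eq_one_iff, Subgroup.mem_subgroupOf] at h3
    exact h3
  · intro h hdvd
    have : Fact p.Prime := ⟨hp⟩
    obtain ⟨S⟩ : Nonempty (Sylow p K) := inferInstance
    refine S.not_dvd_index (hdvd.trans (Subgroup.index_dvd_of_le ?_))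
    intro y hy
    obtain ⟨k, hk⟩ := S.isPGroup' ⟨y, hy⟩
    exact h y y.2 ⟨k, by simpa [Subtype.ext_iff] using hk⟩

end RelIndex

/-! ### Nilpotent subgroups above a self-centralizing normal subgroup. -/

section PrimeComplCentralizer

variable {G : Type*} [Group G]

/-- The centralizer of the elements of `F` of prime power order for the primes other than `p`. -/
def primeComplCentralizer (F : Subgroup G) (p : ℕ) : Subgroup G :=
  Subgroup.centralizer {f | f ∈ F ∧ ∃ q : ℕ, q.Prime ∧ q ≠ p ∧ ∃ k : ℕ, f ^ q ^ k = 1}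

theorem mem_primeComplCentralizer {F : Subgroup G} {p : ℕ} {x : G} :
    x ∈ primeComplCentralizer F p ↔
      ∀ f ∈ F, ∀ q : ℕ, q.Prime → q ≠ p → (∃ k : ℕ, f ^ q ^ k = 1) → Commute f x := by
  simp only [primeComplCentralizer, Subgroup.mem_centralizer_iff, Set.mem_ofPred_eq]
  exact ⟨fun h f hf q hq hqp hk => h f ⟨hf, q, hq, hqp, hk⟩,
    fun h f ⟨hf, q, hq, hqp, hk⟩ => h f hf q hq hqp hk⟩

instance normal_primeComplCentralizer (F : Subgroup G) [hF : F.Normal] (p : ℕ) :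
    (primeComplCentralizer F p).Normal := by
  refine ⟨fun x hx g => ?_⟩
  rw [mem_primeComplCentralizer] at hx ⊢
  intro f hf q hq hqp hk
  have h := hx (g⁻¹ * f * g) (by simpa using hF.conj_mem f hf g⁻¹) q hq hqp
    (by simpa using conj_pow_eq_one g⁻¹ hk)
  have h' := h.map (MulAut.conj g)
  simpa [mul_assoc] using h'

variable [Finite G] {F : Subgroup G}

theorem inf_primeComplCentralizer_le {p q : ℕ} (hpq : p ≠ q) :
    primeComplCentralizer F p ⊓ primeComplCentralizer F q ≤ Subgroup.centralizer (F : Set G) := by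
  rintro x ⟨hxp, hxq⟩
  suffices F ≤ Subgroup.centralizer {x} by
    rw [Subgroup.mem_centralizer_iff]
    intro f hf
    exact (Subgroup.mem_centralizer_singleton_iff.1 (this hf))
  refine Subgroup.le_of_forall_pow_prime_pow fun r hr y hy hk => ?_
  rw [Subgroup.mem_centralizer_singleton_iff]
  rcases eq_or_ne r p with rfl | hrp
  · exact mem_primeComplCentralizer.1 hxq y hy r hr hpq hk
  · exact mem_primeComplCentralizer.1 hxp y hy r hr hrp hk

theorem mem_primeComplCentralizer_of_isNilpotent {K : Subgroup G} (hFK : F ≤ K)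
    (hK : Group.IsNilpotent K) {p : ℕ} (hp : p.Prime) {x : G} (hx : x ∈ K)
    (hxp : ∃ k : ℕ, x ^ p ^ k = 1) : x ∈ primeComplCentralizer F p := by
  rw [mem_primeComplCentralizer]
  exact fun f hf q hq hqp hk => Subgroup.commute_of_isNilpotent hK hq hp hqp (hFK hf) hx hk hxp

variable [F.Normal]

theorem mem_primeComplCentralizer_of_mem_sup {K Q : Subgroup G}
    (h : Q ≤ Subgroup.normalizer (K : Set G)) {p : ℕ} (hp : p.Prime)
    (hK : ∀ x ∈ K, (∃ k : ℕ, x ^ p ^ k = 1) → x ∈ primeComplCentralizer F p)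
    (hQ : ∀ x ∈ Q, (∃ k : ℕ, x ^ p ^ k = 1) → x ∈ primeComplCentralizer F p) :
    ∀ x ∈ K ⊔ Q, (∃ k : ℕ, x ^ p ^ k = 1) → x ∈ primeComplCentralizer F p := by
  rw [← Subgroup.not_dvd_relIndex_iff hp] at hK hQ ⊢
  intro hdvd
  exact (hp.dvd_mul.1 (hdvd.trans (Subgroup.relIndex_sup_dvd_mul h))).elim hK hQ

/-- |F⟨x⟩ : F| is a power of p, so the p'-elements of prime power order lie in F, and the p-elements
lie in C_p. -/
theorem isNilpotent_sup_zpowers (hF : Group.IsNilpotent F) {p : ℕ} (hp : p.Prime) {x : G}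
    (hx : x ∈ primeComplCentralizer F p) (hxp : ∃ k : ℕ, x ^ p ^ k = 1) :
    Group.IsNilpotent (F ⊔ Subgroup.zpowers x : Subgroup G) := by
  have hmemC := mem_primeComplCentralizer_of_mem_sup (F := F) (K := F)
    (Q := Subgroup.zpowers x) (by rw [Subgroup.normalizer_eq_top]; exact le_top) hp
    (fun y hy hk => mem_primeComplCentralizer_of_isNilpotent le_rfl hF hp hy hk)
    (fun y hy _ => (Subgroup.zpowers_le.2 hx) hy)
  have hmemF : ∀ q : ℕ, q.Prime → q ≠ p → ∀ y ∈ F ⊔ Subgroup.zpowers x,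
      (∃ k : ℕ, y ^ q ^ k = 1) → y ∈ F := by
    intro q hq hqp
    rw [← Subgroup.not_dvd_relIndex_iff hq, Subgroup.relIndex_sup_left]
    intro hdvd
    obtain ⟨k, hk⟩ := hxp
    have h1 := hdvd.trans (Subgroup.relIndex_dvd_card F (Subgroup.zpowers x))
    rw [Nat.card_zpowers] at h1
    exact hqp ((Nat.prime_dvd_prime_iff_eq hq hp).1
      (hq.dvd_of_dvd_pow (h1.trans (orderOf_dvd_of_pow_eq_one hk))))
  refine Subgroup.isNilpotent_of_commute fun r s hr hs hrs y hy z hz hyr hzs => ?_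
  rcases eq_or_ne r p with rfl | hrp
  · exact (mem_primeComplCentralizer.1 (hmemC y hy hyr) z (hmemF s hs hrs.symm z hz hzs) s hs
      hrs.symm hzs).symm
  rcases eq_or_ne s p with rfl | hsp
  · exact mem_primeComplCentralizer.1 (hmemC z hz hzs) y (hmemF r hr hrp y hy hyr) r hr hrp hyr
  · exact Subgroup.commute_of_isNilpotent hF hr hs hrs (hmemF r hr hrp y hy hyr)
      (hmemF s hs hsp z hz hzs) hyr hzs

theorem commutator_pow_eq_one (hF : Group.IsNilpotent F) {p : ℕ} (hp : p.Prime) {x g : G}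
    (hx : x ∈ primeComplCentralizer F p) (hxp : ∃ k : ℕ, x ^ p ^ k = 1) (hc : ⁅x, g⁆ ∈ F) :
    ∃ k : ℕ, ⁅x, g⁆ ^ p ^ k = 1 := by
  have hR := isNilpotent_sup_zpowers hF hp hx hxp
  obtain ⟨S, -, hS⟩ := Subgroup.exists_isPGroup_forall_mem_iff hR hp
  have hxR : x ∈ F ⊔ Subgroup.zpowers x := Subgroup.mem_sup_right (Subgroup.mem_zpowers x)
  have hxS : x ∈ S := (hS x).2 ⟨hxR, hxp⟩
  have heq : ⁅x, g⁆ = x * (g * x⁻¹ * g⁻¹) := by simp [commutatorElement_def, mul_assoc]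
  refine ((hS _).1 ?_).2
  rw [heq]
  refine S.mul_mem hxS ((hS _).2 ⟨?_, conj_pow_eq_one g ((hS _).1 (S.inv_mem hxS)).2⟩)
  -- This puts the conjugate of x⁻¹ inside the nilpotent group F⟨x⟩, even though g need not be
  -- there.
  have : g * x⁻¹ * g⁻¹ = x⁻¹ * ⁅x, g⁆ := by simp [heq]
  rw [this]
  exact Subgroup.mul_mem _ (Subgroup.inv_mem _ hxR) (Subgroup.mem_sup_left hc)

/-- The commutator lies in C_p ∩ C_q, hence in F, so it is both a p-element and a q-element. -/
theorem commute_of_mem_primeComplCentralizer (hF : Group.IsNilpotent F)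
    (hFc : Subgroup.centralizer (F : Set G) ≤ F) {p q : ℕ} (hp : p.Prime) (hq : q.Prime)
    (hpq : p ≠ q) {x y : G} (hx : x ∈ primeComplCentralizer F p)
    (hy : y ∈ primeComplCentralizer F q) (hxp : ∃ k : ℕ, x ^ p ^ k = 1)
    (hyq : ∃ k : ℕ, y ^ q ^ k = 1) : Commute x y := by
  have hc : ⁅x, y⁆ ∈ F := hFc (inf_primeComplCentralizer_le hpq
    (Subgroup.commutator_le_inf _ _ (Subgroup.commutator_mem_commutator hx hy)))
  have hc' : ⁅y, x⁆ ∈ F := by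
    rw [← commutatorElement_inv]
    exact F.inv_mem hc
  rw [← commutatorElement_eq_one_iff_commute]
  refine eq_one_of_pow_prime_pow_eq_one hp hq hpq (commutator_pow_eq_one hF hp hx hxp hc) ?_
  obtain ⟨k, hk⟩ := commutator_pow_eq_one hF hq hy hyq hc'
  exact ⟨k, by rw [← commutatorElement_inv, inv_pow, hk, inv_one]⟩

theorem isNilpotent_of_forall_mem_primeComplCentralizer (hF : Group.IsNilpotent F)
    (hFc : Subgroup.centralizer (F : Set G) ≤ F) {K : Subgroup G}
    (hK : ∀ p : ℕ, p.Prime → ∀ x ∈ K, (∃ k : ℕ, x ^ p ^ k = 1) →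
      x ∈ primeComplCentralizer F p) : Group.IsNilpotent K :=
  Subgroup.isNilpotent_of_commute fun p q hp hq hpq x hx y hy hxp hyq =>
    commute_of_mem_primeComplCentralizer hF hFc hp hq hpq (hK p hp x hx hxp) (hK q hq y hy hyq)
      hxp hyq

theorem isNilpotent_sup_of_le_normalizer (hFc : Subgroup.centralizer (F : Set G) ≤ F)
    {K Q : Subgroup G} (hFK : F ≤ K) (hFQ : F ≤ Q) (hK : Group.IsNilpotent K)
    (hQ : Group.IsNilpotent Q) (h : Q ≤ Subgroup.normalizer (K : Set G)) :
    Group.IsNilpotent (K ⊔ Q : Subgroup G) := by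
  have hF : Group.IsNilpotent F :=
    Subgroup.isNilpotent_of_le hFK hK
  exact isNilpotent_of_forall_mem_primeComplCentralizer hF hFc fun p hp =>
    mem_primeComplCentralizer_of_mem_sup h hp
      (fun x hx hxp => mem_primeComplCentralizer_of_isNilpotent hFK hK hp hx hxp)
      (fun x hx hxp => mem_primeComplCentralizer_of_isNilpotent hFQ hQ hp hx hxp)

/-- A Sylow p-subgroup T of C_p containing the p-elements of I is normalized by I, and TI is
nilpotent, so T ≤ I by maximality. Sylow's theorem in C_p then applies. -/
theorem exists_conj_mem_of_isPGroup (hFc : Subgroup.centralizer (F : Set G) ≤ F)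
    {I : Subgroup G} (hFI : F ≤ I) (hI : Maximal (fun N : Subgroup G => Group.IsNilpotent N) I)
    {p : ℕ} (hp : p.Prime) {U : Subgroup G} (hU : IsPGroup p U)
    (hUC : U ≤ primeComplCentralizer F p) :
    ∃ h ∈ primeComplCentralizer F p, ∀ x ∈ U, h * x * h⁻¹ ∈ I := by
  have : Fact p.Prime := ⟨hp⟩
  have hIn := hI.prop
  have hF : Group.IsNilpotent F :=
    Subgroup.isNilpotent_of_le hFI hIn
  have hIC := fun (q : ℕ) (hq : q.Prime) (x : G) (hx : x ∈ I) =>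
    mem_primeComplCentralizer_of_isNilpotent hFI hIn hq hx
  set C := primeComplCentralizer F p
  obtain ⟨S, hSp, hS⟩ := Subgroup.exists_isPGroup_forall_mem_iff hIn hp
  have hSC : S ≤ C := fun x hx => hIC p hp x ((hS x).1 hx).1 ((hS x).1 hx).2
  obtain ⟨T, hST⟩ := (hSp.of_equiv (Subgroup.subgroupOfEquivOfLe hSC).symm).exists_le_sylow
  obtain ⟨T', hUT⟩ := (hU.of_equiv (Subgroup.subgroupOfEquivOfLe hUC).symm).exists_le_sylow
  have hTp : ∀ x : C, x ∈ T → ∃ k : ℕ, (x : G) ^ p ^ k = 1 := by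
    intro x hx
    obtain ⟨k, hk⟩ := T.isPGroup' ⟨x, hx⟩
    exact ⟨k, by simpa [Subtype.ext_iff] using hk⟩
  set T₀ : Subgroup G := (T : Subgroup C).map C.subtype
  have hSmem : ∀ y ∈ I, (∃ k : ℕ, y ^ p ^ k = 1) → y ∈ T₀ := by
    intro y hy hk
    have hyS := (hS y).2 ⟨hy, hk⟩
    exact ⟨⟨y, hSC hyS⟩, hST (Subgroup.mem_subgroupOf.2 hyS), rfl⟩
  have hnorm : I ≤ Subgroup.normalizer (T₀ : Set G) := by
    refine Subgroup.le_of_forall_pow_prime_pow fun q hq y hy hk => ?_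
    rcases eq_or_ne q p with rfl | hqp
    · exact Subgroup.le_normalizer (hSmem y hy hk)
    · refine Subgroup.centralizer_le_normalizer _ (Subgroup.mem_centralizer_iff.2 ?_)
      rintro _ ⟨x, hx, rfl⟩
      exact commute_of_mem_primeComplCentralizer hF hFc hp hq hqp.symm x.2 (hIC q hq y hy hk)
        (hTp x hx) hk
  have hnil : Group.IsNilpotent (T₀ ⊔ I : Subgroup G) := by
    refine isNilpotent_of_forall_mem_primeComplCentralizer hF hFc fun q hq =>
      mem_primeComplCentralizer_of_mem_sup hnorm hq ?_ (hIC q hq)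
    rintro _ ⟨x, hx, rfl⟩ hk
    rcases eq_or_ne q p with rfl | hqp
    · exact x.2
    · rw [eq_one_of_pow_prime_pow_eq_one hq hp hqp hk (hTp x hx)]
      exact Subgroup.one_mem _
  have hTI : T₀ ≤ I := le_sup_left.trans (hI.le_of_ge hnil le_sup_right)
  obtain ⟨h, hh⟩ := MulAction.exists_smul_eq C T' T
  refine ⟨h, h.2, fun x hx => hTI ⟨h * ⟨x, hUC hx⟩ * h⁻¹, ?_, rfl⟩⟩
  have hxT : (⟨x, hUC hx⟩ : C) ∈ (T' : Subgroup C) := hUT (Subgroup.mem_subgroupOf.2 hx)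
  rw [← hh]
  exact Subgroup.smul_mem_pointwise_smul _ (MulAut.conj h) (T' : Subgroup C) hxT

/-- The maximal nilpotent subgroups containing a normal subgroup that contains its own centralizer
are conjugate. -/
theorem exists_le_conj_of_isNilpotent (hFc : Subgroup.centralizer (F : Set G) ≤ F)
    {I : Subgroup G} (hFI : F ≤ I) (hI : Maximal (fun N : Subgroup G => Group.IsNilpotent N) I)
    {K : Subgroup G} (hFK : F ≤ K) (hK : Group.IsNilpotent K) :
    ∃ g : G, K ≤ MulAut.conj g • I := by
  have key : ∀ s : Finset ℕ, (∀ p ∈ s, p.Prime) →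
      ∃ g : G, ∀ p ∈ s, ∀ x ∈ K, (∃ k : ℕ, x ^ p ^ k = 1) → g * x * g⁻¹ ∈ I := by
    intro s
    induction s using Finset.induction_on with
    | empty => exact fun _ => ⟨1, by simp⟩
    | insert p s hps ih =>
      intro hs
      have hp := hs p (Finset.mem_insert_self p s)
      obtain ⟨g, hg⟩ := ih fun q hq => hs q (Finset.mem_insert_of_mem hq)
      have hconj : ∀ (q : ℕ), q.Prime → ∀ x ∈ K, (∃ k : ℕ, x ^ q ^ k = 1) →
          g * x * g⁻¹ ∈ primeComplCentralizer F q := fun q hq x hx hk =>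
        (normal_primeComplCentralizer F q).conj_mem x
          (mem_primeComplCentralizer_of_isNilpotent hFK hK hq hx hk) g
      obtain ⟨U, hUp, hU⟩ := Subgroup.exists_isPGroup_forall_mem_iff hK hp
      obtain ⟨h, hhC, hh⟩ := exists_conj_mem_of_isPGroup hFc hFI hI hp
        (hUp.map (MulAut.conj g).toMonoidHom) (by
          rintro _ ⟨x, hx, rfl⟩
          exact hconj p hp x ((hU x).1 hx).1 ((hU x).1 hx).2)
      refine ⟨h * g, fun q hq x hx hk => ?_⟩
      rcases Finset.mem_insert.1 hq with rfl | hqs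
      · have := hh (g * x * g⁻¹) ⟨x, (hU x).2 ⟨hx, hk⟩, rfl⟩
        simpa [mul_assoc] using this
      · have hpq : p ≠ q := fun e => hps (e ▸ hqs)
        -- Since h is in C_p, conjugating by it changes the q-elements already moved into I only by
        -- factors in F ≤ I.
        have hc : ⁅h, g * x * g⁻¹⁆ ∈ F := hFc (inf_primeComplCentralizer_le hpq
          (Subgroup.commutator_le_inf _ _ (Subgroup.commutator_mem_commutator hhC
            (hconj q (hs q hq) x hx hk))))
        have := I.mul_mem (hFI hc) (hg q hqs x hx hk)
        simpa [commutatorElement_def, mul_assoc] using this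
  obtain ⟨g, hg⟩ := key (Nat.card G).primeFactors fun p hp => Nat.prime_of_mem_primeFactors hp
  refine ⟨g⁻¹, Subgroup.le_of_forall_pow_prime_pow fun q hq y hy hk => ?_⟩
  rw [Subgroup.mem_pointwise_smul_iff_inv_smul_mem, map_inv, inv_inv, MulAut.smul_def,
    MulAut.conj_apply]
  by_cases hqG : q ∣ Nat.card G
  · exact hg q (Nat.mem_primeFactors.2 ⟨hq, hqG, Nat.card_pos.ne'⟩) y hy hk
  · obtain ⟨k, hk⟩ := hk
    have : y = 1 := by
      rw [← orderOf_eq_one_iff]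
      exact Nat.eq_one_of_dvd_coprimes
        (Nat.Coprime.pow_left k ((Nat.Prime.coprime_iff_not_dvd hq).2 hqG))
        (orderOf_dvd_of_pow_eq_one hk) (orderOf_dvd_natCard y)
    simp [this]

end PrimeComplCentralizer

/-! ### Injectors and the divisibility theorem. -/

section Injector

variable {G : Type*} [Group G]

theorem fittingSubgroup_normal (G : Type*) [Group G] : (fittingSubgroup G).Normal := by
  have : fittingSubgroup G =
      ⨆ N : {N : Subgroup G // N.Normal ∧ Group.IsNilpotent N}, (N : Subgroup G) :=
    sSup_eq_iSup' _
  rw [this]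
  have : ∀ N : {N : Subgroup G // N.Normal ∧ Group.IsNilpotent N}, (N : Subgroup G).Normal :=
    fun N => N.2.1
  infer_instance

theorem IsNilpotentInjector.maximal {I : Subgroup G} (hI : IsNilpotentInjector I) :
    Maximal (fun N : Subgroup G => Group.IsNilpotent N) I := by
  simpa using hI ⊤ Subgroup.IsSubnormal.top

theorem IsNilpotentInjector.fittingSubgroup_le {I : Subgroup G} (hI : IsNilpotentInjector I) :
    fittingSubgroup G ≤ I := by
  refine sSup_le fun N hN => ?_
  have h := (hI N (Subgroup.Normal.isSubnormal hN.1)).le_of_ge ⟨le_rfl, hN.2⟩ inf_le_left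
  exact h.trans inf_le_right

/-- The conjugation action of `I` on the subgroups contained in a conjugate of `I`. -/
@[reducible]
def conjActionSubgroupsOfConjugates (I : Subgroup G) : MulAction I (subgroupsOfConjugates I) where
  smul a K := ⟨MulAut.conj (a : G) • (K : Subgroup G), by
    obtain ⟨g, hg⟩ := K.2
    refine ⟨a * g, ?_⟩
    rw [map_mul, mul_smul]
    exact Subgroup.pointwise_smul_le_pointwise_smul_iff.2 hg⟩
  one_smul K := Subtype.ext (by
    change MulAut.conj ((1 : I) : G) • (K : Subgroup G) = K
    simp)
  mul_smul a b K := Subtype.ext (by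
    change MulAut.conj ((a * b : I) : G) • (K : Subgroup G) =
      MulAut.conj (a : G) • MulAut.conj (b : G) • (K : Subgroup G)
    rw [Subgroup.coe_mul, map_mul, mul_smul])

end Injector

/-- Of the injector property only F ≤ I and maximal nilpotency are needed. -/
theorem relIndex_dvd_moebiusSum {G : Type*} [Group G] [Finite G] {F I : Subgroup G}
    (hFn : F.Normal) (hG : Subgroup.centralizer (F : Set G) ≤ F) (hFI : F ≤ I)
    (hmax : Maximal (fun N : Subgroup G => Group.IsNilpotent N) I) :
    ((F.relIndex I : ℕ) : ℤ) ∣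
      moebiusSum (subgroupsOfConjugates I) ⟨F, mem_subgroupsOfConjugates_of_le hFI⟩ := by
  classical
  have hnil : ∀ K ∈ subgroupsOfConjugates I, Group.IsNilpotent K := by
    rintro K ⟨g, hg⟩
    have := hmax.prop
    exact Subgroup.isNilpotent_of_le hg
      (Group.nilpotent_of_mulEquiv (Subgroup.equivSMul (MulAut.conj g) I))
  let : MulAction I (subgroupsOfConjugates I) := conjActionSubgroupsOfConjugates I
  let : Fintype (subgroupsOfConjugates I) := Fintype.ofFinite _
  have hsmul : ∀ (a : I) (K : subgroupsOfConjugates I),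
      ((a • K : subgroupsOfConjugates I) : Subgroup G) = MulAut.conj (a : G) • (K : Subgroup G) :=
    fun _ _ => rfl
  have hstab : ∀ (a : I) (K : subgroupsOfConjugates I), a ∈ MulAction.stabilizer I K ↔
      (a : G) ∈ Subgroup.normalizer ((K : Subgroup G) : Set G) := by
    intro a K
    rw [MulAction.mem_stabilizer_iff, Subtype.ext_iff, hsmul,
      Subgroup.mem_normalizer_iff_map_conj_eq]
    rfl
  have hmono : ∀ (a : I) (x y : subgroupsOfConjugates I), x ≤ y → a • x ≤ a • y :=
    fun a x y h => Subgroup.pointwise_smul_le_pointwise_smul_iff.2 h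
  have hFfix : ∀ a : I, MulAut.conj (a : G) • F = F := fun a =>
    Subgroup.Normal.conj_smul_eq_self (a : G) F
  change _ ∣ ∑ K, moebius _ K
  rw [sum_moebius_eq_chainSum]
  refine index_dvd_chainSum hmono (F.subgroupOf I) _ ?_ ?_ ?_
  · intro a K hK
    simp only [Finset.mem_filter, Finset.mem_univ, true_and, ← Subtype.coe_lt_coe, hsmul] at hK ⊢
    rw [← hFfix a]
    exact lt_of_le_not_ge (Subgroup.pointwise_smul_le_pointwise_smul_iff.2 hK.le)
      fun h => hK.not_ge (Subgroup.pointwise_smul_le_pointwise_smul_iff.1 h)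
  · intro K hK a ha
    simp only [Finset.mem_filter, Finset.mem_univ, true_and] at hK
    exact (hstab a K).2 (Subgroup.le_normalizer (hK.le (Subgroup.mem_subgroupOf.1 ha)))
  · intro B hB
    have hFB : F < B.map I.subtype := by
      have := Subgroup.map_lt_map_iff_of_injective I.subtype_injective |>.2 hB
      rwa [Subgroup.subgroupOf_map_subtype, inf_eq_left.2 hFI] at this
    have hBI : B.map I.subtype ≤ I := Subgroup.map_subtype_le B
    have hmem : ∀ K : subgroupsOfConjugates I,
        K ∈ ((Finset.univ.filter fun K : subgroupsOfConjugates I =>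
          ⟨F, mem_subgroupsOfConjugates_of_le hFI⟩ < K).filter
          fun K => B ≤ MulAction.stabilizer I K) ↔
        F < K ∧ B.map I.subtype ≤ Subgroup.normalizer ((K : Subgroup G) : Set G) := by
      intro K
      simp only [Finset.mem_filter, Finset.mem_univ, true_and, ← Subtype.coe_lt_coe,
        Subgroup.map_le_iff_le_comap]
      refine and_congr Iff.rfl (forall_congr' fun a => imp_congr Iff.rfl (hstab a K))
    refine chainSum_eq_zero_of_exists_isLUB (b := ⟨B.map I.subtype,
      mem_subgroupsOfConjugates_of_le hBI⟩) _ ((hmem _).2 ⟨hFB, Subgroup.le_normalizer⟩) ?_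
    intro K hK
    obtain ⟨hFK, hKn⟩ := (hmem K).1 hK
    -- B normalizes K, so KB is nilpotent and thus in 𝒳; B normalizes KB because it lies in it.
    refine ⟨⟨K ⊔ B.map I.subtype, exists_le_conj_of_isNilpotent hG hFI hmax
      (hFK.le.trans le_sup_left) ?_⟩, (hmem _).2 ⟨hFK.trans_le le_sup_left, ?_⟩, ?_⟩
    · exact isNilpotent_sup_of_le_normalizer hG hFK.le hFB.le (hnil K K.2)
        (hnil _ (mem_subgroupsOfConjugates_of_le hBI)) hKn
    · exact le_sup_right.trans Subgroup.le_normalizer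
    · constructor
      · rintro L (hL | hL)
        · rw [hL]
          exact le_sup_left (a := (K : Subgroup G))
        · rw [hL]
          exact le_sup_right (a := (K : Subgroup G))
      · intro j hj
        exact sup_le (α := Subgroup G) (hj (Set.mem_insert _ _)) (hj (Set.mem_insert_of_mem _ rfl))

theorem theoremB {G : Type*} [Group G] [Finite G] [Nontrivial G] (hG : IsNConstrained G)
    (I : Subgroup G) (hI : IsNilpotentInjector I) :
    ∃ hF : fittingSubgroup G ≤ I,
      (((fittingSubgroup G).relIndex I : ℕ) : ℤ) ∣
        moebiusSum (subgroupsOfConjugates I)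
          ⟨fittingSubgroup G, mem_subgroupsOfConjugates_of_le hF⟩ :=
  ⟨hI.fittingSubgroup_le, relIndex_dvd_moebiusSum (fittingSubgroup_normal G) hG
    hI.fittingSubgroup_le hI.maximal⟩
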